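/- \textbf{Proposition 1 (Optimality and Quadratic Droop).} \emph{Network.} Let $\mathcal L$ ($n=|\mathcal L|\ge 1$ load buses) and $\mathcal I$ ($m=|\mathcal I|\ge 1$ inverter buses) be disjoint finite sets, and let $(\mathcal L\cup\mathcal I,\mathcal E)$ be a connected graph. Each branch $\{i,j\}\in\mathcal E$ has susceptance $b_{ij}=b_{ji}<0$, and $b_{ij}=0$ for $\{i,j\}\notin\mathcal E$. Let $B$ be the susceptance matrix, $B_{ij}=-b_{ij}$ for $i\ne j$ and $B_{ii}=\sum_{j\ne i}b_{ij}$, with blocks $B_{LL},B_{LI},B_{IL},B_{II}$. For a vector $x$, $[x]$ is the diagonal matrix with diagonal $x$. \emph{Closed loop.} Let $\tau_i>0$, $K_i<0$, $E_i^*>0$ for $i\in\mathcal I$, $E_I^*=(E_i^*)_{i\in\mathcal I}$, $K_I=[(K_i)_{i\in\mathcal I}]$, and $b_{\rm shunt}\in\mathbb R^n$. Consider, for positive voltages $E=(E_L,E_I)\in\mathbb R^{n+m}_{>0}$, the differential-algebraic system $$0=b_{{\rm shunt},i}E_i^2+E_i(BE)_i\ \ (i\in\mathcal L),\qquad \tau_i\dot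 E_i=K_iE_i(E_i-E_i^*)+E_i(BE)_i\ \ (i\in\mathcal I),$$ that is, constant-impedance loads $Q_i(E_i)=b_{{\rm shunt},i}E_i^2$ and the quadratic droop controller at the inverters. An equilibrium $\bar E$ is \emph{locally exponentially stable} if there are $\delta,c,r>0$ such that from every state $E_0\in\mathbb R^{n+m}_{>0}$ which satisfies the load equations and $\|E_0-\bar E\|<\delta$ there starts a solution on $[0,\infty)$, and every solution on an interval $[0,T)$ with $\|E(0)-\bar E\|<\delta$ satisfies $\|E(t)-\bar E\|\le c\,e^{-rt}\|E(0)-\bar E\|$ on $[0,T)$. \emph{Reduced quantities.} Put $$B_{\rm red}=B_{LL}-B_{LI}(B_{II}+K_I)^{-1}B_{IL},\quad W_1=-B_{\rm red}^{-1}B_{LI}(B_{II}+K_I)^{-1}K_I,\quad W_2=(B_{II}+K_I)^{-1}\begin{pmatrix}-B_{IL}&K_I\end{pmatrix},\quad E_L^*=W_1E_I^*.$$ \emph{Optimization problem.} For $\kappa_i<0$, $i\in\mathcal I$, consider minimizing over $E\in\mathbb R^{n+m}_{>0}$ the cost $$C(E)=\sum_{\{i,j\}\in\mathcal E}B_{ij}(E_i-E_j)^2-\sum_{i\in\mathcal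 L}b_{{\rm shunt},i}E_i^2-\sum_{i\in\mathcal I}\kappa_i(E_i-E_i^*)^2 .$$ \emph{Claim.} Assume that $-(B_{\rm red}+[b_{\rm shunt}])$ is an $M$-matrix (off-diagonal entries $\le 0$, all eigenvalues with positive real part) and that $K_i=\kappa_i$ for every $i\in\mathcal I$. Then the matrices $B_{II}+K_I$, $B_{\rm red}$ and $B_{\rm red}+[b_{\rm shunt}]$ are invertible. The closed-loop system has exactly one equilibrium $(E_L^{\rm Z},E_I^{\rm Z})\in\mathbb R^{n+m}_{>0}$, and it is locally exponentially stable. The optimization problem has exactly one minimizer, and it is the same point $(E_L^{\rm Z},E_I^{\rm Z})$. Both are given by $$E_L^{\rm Z}=(B_{\rm red}+[b_{\rm shunt}])^{-1}B_{\rm red}E_L^*\in\mathbb R^n_{>0},\qquad E_I^{\rm Z}=W_2\begin{pmatrix}E_L^{\rm Z}\\E_I^*\end{pmatrix}\in\mathbb R^m_{>0}.$$ -/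

import Mathlib

open Matrix Set

/-- An `M`-matrix: a real square matrix with nonpositive off-diagonal entries, all of whose
(complex) eigenvalues have positive real part. -/
def IsMMatrix {ι : Type*} [Fintype ι] [DecidableEq ι] (A : Matrix ι ι ℝ) : Prop :=
  (∀ i j, i ≠ j → A i j ≤ 0) ∧
    ∀ μ : ℂ, Module.End.HasEigenvalue (Matrix.toLin' (A.map (algebraMap ℝ ℂ))) μ → 0 < μ.re

/-- A droop-controlled microgrid with load buses `L` and inverter buses `I`: a connected graph
whose branches `{i, j}` are lossless inductive lines of admittance `𝐣 b i j` with `b i j < 0`,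
together with the time constants `τ`, the controller gains `K` and the voltage set points `Eset`
of the inverters. -/
structure Microgrid (L I : Type*) where
  /-- the graph of buses and branches -/
  graph : SimpleGraph (L ⊕ I)
  connected : graph.Connected
  /-- branch susceptances -/
  b : L ⊕ I → L ⊕ I → ℝ
  b_symm : ∀ i j, b i j = b j i
  b_neg : ∀ i j, graph.Adj i j → b i j < 0
  b_zero : ∀ i j, ¬ graph.Adj i j → b i j = 0
  /-- time constants of the inverters -/
  τ : I → ℝ
  τ_pos : ∀ i, 0 < τ i
  /-- controller gains -/
  K : I → ℝ
  K_neg : ∀ i, K i < 0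
  /-- set points of the inverter voltages -/
  Eset : I → ℝ
  Eset_pos : ∀ i, 0 < Eset i

/-- Constant-impedance loads: load `i` injects the reactive power `bshunt i * x ^ 2` at voltage
`x`. -/
def constantImpedance {L : Type*} (bshunt : L → ℝ) (i : L) (x : ℝ) : ℝ :=
  bshunt i * x ^ 2

/-- The strictly positive voltage profiles. -/
def positiveVoltages (V : Type*) : Set (V → ℝ) := {E | ∀ i, 0 < E i}

namespace Microgrid

variable {L I : Type*} [Fintype L] [Fintype I] [DecidableEq L] [DecidableEq I]

/-- The susceptance matrix `B`, the imaginary part of the bus admittance matrix `Y = 𝐣 B`: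
`Y i j = - y i j` off the diagonal and `Y i i = ∑ j ≠ i, y i j`. -/
def B (N : Microgrid L I) : Matrix (L ⊕ I) (L ⊕ I) ℝ :=
  Matrix.of fun i j =>
    if i = j then ∑ k ∈ Finset.univ.erase i, N.b i k else - N.b i j

theorem B_symm (N : Microgrid L I) (i j : L ⊕ I) : N.B i j = N.B j i := by
  by_cases h : i = j
  · rw [h]
  · simp [B, h, Ne.symm h, N.b_symm i j]

/-! The blocks of `B`. -/

/-- load-load block -/
def BLL (N : Microgrid L I) : Matrix L L ℝ := N.B.toBlocks₁₁

/-- load-inverter block -/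
def BLI (N : Microgrid L I) : Matrix L I ℝ := N.B.toBlocks₁₂

/-- inverter-load block -/
def BIL (N : Microgrid L I) : Matrix I L ℝ := N.B.toBlocks₂₁

/-- inverter-inverter block -/
def BII (N : Microgrid L I) : Matrix I I ℝ := N.B.toBlocks₂₂

/-- The diagonal matrix of controller gains. -/
def KI (N : Microgrid L I) : Matrix I I ℝ := Matrix.diagonal N.K

/-- The reduced susceptance matrix. -/
noncomputable def Bred (N : Microgrid L I) : Matrix L L ℝ :=
  N.BLL - N.BLI * (N.BII + N.KI)⁻¹ * N.BIL

/-- The first averaging matrix. -/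
noncomputable def W₁ (N : Microgrid L I) : Matrix L I ℝ :=
  - (N.Bred⁻¹ * N.BLI * (N.BII + N.KI)⁻¹ * N.KI)

/-- The second averaging matrix. -/
noncomputable def W₂ (N : Microgrid L I) : Matrix I (L ⊕ I) ℝ :=
  (N.BII + N.KI)⁻¹ * Matrix.fromCols (- N.BIL) N.KI

/-- The open-circuit load voltages. -/
noncomputable def ELopen (N : Microgrid L I) : L → ℝ := N.W₁ *ᵥ N.Eset

/-- The reactive power injected into the network at bus `i`. -/
def Qe (N : Microgrid L I) (E : L ⊕ I → ℝ) (i : L ⊕ I) : ℝ :=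
  - E i * ∑ j, N.B i j * E j

/-- The reactive power mismatch at load `i` under the static load model `Q`. -/
def loadResidual (N : Microgrid L I) (Q : L → ℝ → ℝ) (E : L ⊕ I → ℝ) (i : L) : ℝ :=
  Q i (E (Sum.inl i)) - N.Qe E (Sum.inl i)

/-- The quadratic droop control input of inverter `i`. -/
def droopInput (N : Microgrid L I) (E : L ⊕ I → ℝ) (i : I) : ℝ :=
  N.K i * E (Sum.inr i) * (E (Sum.inr i) - N.Eset i) - N.Qe E (Sum.inr i)

/-- Positive voltages that satisfy the power balance equations at all loads, i.e. the consistent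
states of the differential-algebraic closed loop. -/
def IsConsistent (N : Microgrid L I) (Q : L → ℝ → ℝ) (E : L ⊕ I → ℝ) : Prop :=
  E ∈ positiveVoltages (L ⊕ I) ∧ ∀ i, N.loadResidual Q E i = 0

/-- Equilibria, with positive voltages, of the closed loop. -/
def IsEquilibrium (N : Microgrid L I) (Q : L → ℝ → ℝ) (E : L ⊕ I → ℝ) : Prop :=
  N.IsConsistent Q E ∧ ∀ i, N.droopInput E i = 0

/-- `E` is a solution, on the time interval `s` and with positive voltages, of the closed-loop
differential-algebraic system `0 = Q i (E i) - Qe i` at the loads and `τ i * (d/dt) E i = u i` at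
the inverters. -/
def IsSolutionOn (N : Microgrid L I) (Q : L → ℝ → ℝ) (s : Set ℝ) (E : ℝ → L ⊕ I → ℝ) : Prop :=
  ContinuousOn E s ∧ ∀ t ∈ s, N.IsConsistent Q (E t) ∧
    ∀ i, ∃ v : ℝ, HasDerivWithinAt (fun r => E r (Sum.inr i)) v s t ∧
      N.τ i * v = N.droopInput (E t) i

/-- Local exponential stability of an equilibrium of the closed-loop differential-algebraic
system: from every consistent state near it there starts a solution for all positive times, and
every solution that starts near it, on whatever time interval `[0, T)` it is given, converges
exponentially with uniform constants. -/
def IsLocallyExponentiallyStable (N : Microgrid L I) (Q : L → ℝ → ℝ) (Eeq : L ⊕ I → ℝ) : Prop :=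
  N.IsEquilibrium Q Eeq ∧
    ∃ δ > 0, ∃ c > 0, ∃ r > 0,
      (∀ E₀, N.IsConsistent Q E₀ → ‖E₀ - Eeq‖ < δ →
        ∃ E : ℝ → L ⊕ I → ℝ, N.IsSolutionOn Q (Ici 0) E ∧ E 0 = E₀) ∧
      ∀ T > 0, ∀ E : ℝ → L ⊕ I → ℝ, N.IsSolutionOn Q (Ico 0 T) E → ‖E 0 - Eeq‖ < δ →
        ∀ t ∈ Ico 0 T, ‖E t - Eeq‖ ≤ c * Real.exp (- r * t) * ‖E 0 - Eeq‖

open Classical in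
/-- The reactive power absorbed by the lines, a sum over the branches of the network. -/
noncomputable def Qloss (N : Microgrid L I) (E : L ⊕ I → ℝ) : ℝ :=
  ∑ e ∈ N.graph.edgeFinset,
    Sym2.lift ⟨fun i j => N.B i j * (E i - E j) ^ 2, fun i j => by
      change N.B i j * (E i - E j) ^ 2 = N.B j i * (E j - E i) ^ 2
      rw [N.B_symm i j]; ring⟩ e

/-- The reactive power consumed by constant-impedance loads. -/
def Qload (bshunt : L → ℝ) (E : L ⊕ I → ℝ) : ℝ :=
  - ∑ i, bshunt i * E (Sum.inl i) ^ 2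

/-- The weighted deviation of the inverter voltages from their set points. -/
def Cvolt (N : Microgrid L I) (κ : I → ℝ) (E : L ⊕ I → ℝ) : ℝ :=
  - ∑ i, κ i * (E (Sum.inr i) - N.Eset i) ^ 2

/-- The total cost. -/
noncomputable def cost (N : Microgrid L I) (bshunt : L → ℝ) (κ : I → ℝ) (E : L ⊕ I → ℝ) : ℝ :=
  N.Qloss E + Qload bshunt E + N.Cvolt κ E

/-- `E` minimizes the total cost over all positive voltages. -/
def IsMinimizer (N : Microgrid L I) (bshunt : L → ℝ) (κ : I → ℝ) (E : L ⊕ I → ℝ) : Prop :=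
  E ∈ positiveVoltages (L ⊕ I) ∧ IsMinOn (N.cost bshunt κ) (positiveVoltages (L ⊕ I)) E

end Microgrid

/-! Everything is governed by one symmetric matrix, `stiffness` A = -(B + diag(bshunt, K)). At
positive voltages each equilibrium equation can be divided by its voltage, leaving the linear system
A E = d with d = `drive` = (0, -K E*). With κ = K the cost is Eᵀ A E - 2 Eᵀ d plus a constant, so
its critical points solve the same system.

The Schur complement of A over the inverter block is -(Bred + [bshunt]). A symmetric M-matrix is
positive definite, hence so is A (`posDef_stiffness_iff`). The system then has one solution, which
block elimination identifies with the stated formulas; it is positive by the sign pattern of A and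
connectedness, and it minimizes the cost by completing the square.

For stability, the load equations are solved as E_L = G E_I (`exists_kron_reduction`). The inverter
voltages x then follow the Lotka-Volterra system τ_i x_i' = -x_i (R (x - a))_i with R positive
definite. The energy (x - a)ᵀ R (x - a) has derivative -2 ∑ (x_i / τ_i) (R (x - a))_i², which gives
exponential decay near a. Existence for all time comes from a bounded Lipschitz truncation of this
field. -/

/-! ### Positive definite matrices and M-matrices. -/

theorem Matrix.posDef_fromBlocks₂₂_iff {m n : Type*} [Fintype m] [Fintype n] [DecidableEq m]
    [DecidableEq n] (A : Matrix m m ℝ) (B : Matrix m n ℝ) {D : Matrix n n ℝ} (hD : D.PosDef) :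
    (fromBlocks A B Bᵀ D).PosDef ↔ (A - B * D⁻¹ * Bᵀ).PosDef := by
  have := hD.isUnit.invertible
  have key := PosDef.fromBlocks₂₂ A B hD
  rw [conjTranspose_eq_transpose_of_trivial] at key
  -- The semidefinite criterion `key` upgrades to definiteness because a semidefinite matrix is
  -- definite once its determinant is nonzero, and determinants factor through the Schur complement.
  have hdet := det_fromBlocks₂₂ A B Bᵀ D
  rw [invOf_eq_nonsing_inv] at hdet
  constructor
  · intro h
    rw [(key.1 h.posSemidef).posDef_iff_det_ne_zero]
    intro h0
    exact h.det_pos.ne' (by rw [hdet, h0, mul_zero])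
  · intro h
    rw [(key.2 h.posSemidef).posDef_iff_det_ne_zero, hdet]
    exact mul_ne_zero hD.det_pos.ne' h.det_pos.ne'

/-- A real eigenvector of a symmetric matrix, read over ℂ, is an eigenvector for the same real
eigenvalue, so the spectral condition applies to it. -/
theorem IsMMatrix.posDef {ι : Type*} [Fintype ι] [DecidableEq ι] {A : Matrix ι ι ℝ}
    (hA : IsMMatrix A) (hsymm : A.IsHermitian) : A.PosDef := by
  rw [hsymm.posDef_iff_eigenvalues_pos]
  intro j
  set v : ι → ℝ := ⇑(hsymm.eigenvectorBasis j) with hv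
  have hv0 : v ≠ 0 := by
    intro h
    refine hsymm.eigenvectorBasis.orthonormal.ne_zero j ?_
    ext i
    exact congrFun h i
  have hAv : A *ᵥ v = hsymm.eigenvalues j • v := hsymm.mulVec_eigenvectorBasis j
  have := hA.2 (hsymm.eigenvalues j : ℂ) ?_
  · simpa using this
  refine Module.End.hasEigenvalue_of_hasEigenvector (x := fun i => (v i : ℂ)) ?_
  rw [Module.End.hasEigenvector_iff, Module.End.mem_eigenspace_iff]
  refine ⟨?_, fun h => hv0 (funext fun i => by simpa using congrFun h i)⟩
  ext i
  have := congrFun hAv i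
  simp only [mulVec, dotProduct, Pi.smul_apply, smul_eq_mul] at this
  simp only [toLin'_apply, mulVec, dotProduct, map_apply, Complex.coe_algebraMap, Pi.smul_apply,
    smul_eq_mul]
  exact_mod_cast this

/-- A positive definite matrix with nonpositive off-diagonal entries is inverse-nonnegative. -/
theorem Matrix.PosDef.nonneg_of_mulVec_nonneg {ι : Type*} [Fintype ι]
    {A : Matrix ι ι ℝ} (hA : A.PosDef) (hoff : ∀ i j, i ≠ j → A i j ≤ 0) {x : ι → ℝ}
    (hx : ∀ i, 0 ≤ (A *ᵥ x) i) (i : ι) : 0 ≤ x i := by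
  by_contra! hi
  -- The negative part m and the positive part x + m have disjoint supports, so mᵀ A (x + m)
  -- involves only off-diagonal entries. It is ≤ 0, against mᵀ A x ≥ 0 and mᵀ A m > 0.
  set m : ι → ℝ := fun i => max (-x i) 0 with hm
  have hm0 : m ≠ 0 := fun h => by
    have := congrFun h i
    simp only [hm, Pi.zero_apply, max_eq_right_iff] at this
    linarith
  have hpos := hA.dotProduct_mulVec_pos hm0
  have h1 : 0 ≤ m ⬝ᵥ (A *ᵥ x) :=
    Finset.sum_nonneg fun i _ => mul_nonneg (le_max_right _ _) (hx i)
  have h2 : m ⬝ᵥ (A *ᵥ (x + m)) ≤ 0 := by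
    simp only [dotProduct, mulVec, Finset.mul_sum]
    refine Finset.sum_nonpos fun i _ => Finset.sum_nonpos fun j _ => ?_
    have hj : 0 ≤ (x + m) j := by
      have := le_max_left (-x j) 0
      simp only [Pi.add_apply, hm]; linarith
    rcases eq_or_ne i j with rfl | hij
    · rcases le_total (x i) 0 with h | h
      · simp [hm, h]
      · simp [hm, h]
    · exact mul_nonpos_of_nonneg_of_nonpos (le_max_right _ _)
        (mul_nonpos_of_nonpos_of_nonneg (hoff i j hij) hj)
  rw [mulVec_add, dotProduct_add] at h2
  simp only [star_trivial] at hpos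
  linarith

theorem Matrix.exists_norm_mulVec_le {m n : Type*} [Fintype m] [Fintype n] (A : Matrix m n ℝ) :
    ∃ C > 0, ∀ x, ‖A *ᵥ x‖ ≤ C * ‖x‖ := by
  obtain ⟨C, hC, h⟩ := (LinearMap.toContinuousLinearMap A.mulVecLin).bound
  exact ⟨C, hC, h⟩

theorem dotProduct_le_card_mul_norm {ι : Type*} [Fintype ι] (x y : ι → ℝ) :
    x ⬝ᵥ y ≤ Fintype.card ι * (‖x‖ * ‖y‖) := by
  calc x ⬝ᵥ y ≤ ∑ _i : ι, ‖x‖ * ‖y‖ := Finset.sum_le_sum fun i _ => by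
        calc x i * y i ≤ |x i * y i| := le_abs_self _
          _ = ‖x i‖ * ‖y i‖ := abs_mul _ _
          _ ≤ ‖x‖ * ‖y‖ := by gcongr <;> exact norm_le_pi_norm _ i
    _ = _ := by simp

/-- The constant is the minimum of the form on the compact unit sphere of the sup norm; homogeneity
does the rest. -/
theorem Matrix.PosDef.exists_mul_sq_norm_le {ι : Type*} [Fintype ι] {A : Matrix ι ι ℝ}
    (hA : A.PosDef) : ∃ c > 0, ∀ x, c * ‖x‖ ^ 2 ≤ x ⬝ᵥ (A *ᵥ x) := by
  have hcont : Continuous fun x : ι → ℝ => x ⬝ᵥ (A *ᵥ x) := by fun_prop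
  rcases (Metric.sphere (0 : ι → ℝ) 1).eq_empty_or_nonempty with he | hne
  · refine ⟨1, one_pos, fun x => ?_⟩
    rcases eq_or_ne x 0 with rfl | hx
    · simp
    · have : ‖x‖⁻¹ • x ∈ Metric.sphere (0 : ι → ℝ) 1 := by
        simp [norm_smul, hx]
      simp [he] at this
  · obtain ⟨u, hu, hmin⟩ := (isCompact_sphere (0 : ι → ℝ) 1).exists_isMinOn hne hcont.continuousOn
    have hu0 : u ≠ 0 := by
      rintro rfl
      simp at hu
    refine ⟨u ⬝ᵥ (A *ᵥ u), by simpa using hA.dotProduct_mulVec_pos hu0, fun x => ?_⟩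
    rcases eq_or_ne x 0 with rfl | hx
    · simp
    · have hxs : ‖x‖⁻¹ • x ∈ Metric.sphere (0 : ι → ℝ) 1 := by
        simp [norm_smul, hx]
      have h := hmin hxs
      have hn : 0 < ‖x‖ := norm_pos_iff.2 hx
      simp only [mem_ofPred_eq, mulVec_smul, dotProduct_smul, smul_dotProduct, smul_eq_mul] at h
      calc _ ≤ (‖x‖⁻¹ * (‖x‖⁻¹ * x ⬝ᵥ (A *ᵥ x))) * ‖x‖ ^ 2 := by gcongr
        _ = _ := by field_simp

/-! ### Global existence for ordinary differential equations. -/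

/-- A bounded, globally Lipschitz vector field has solutions for all positive times. -/
theorem exists_forall_nonneg_hasDerivWithinAt {E : Type*} [NormedAddCommGroup E] [NormedSpace ℝ E]
    [CompleteSpace E] {F : E → E} {K M : NNReal} (hF : LipschitzWith K F) (hM : ∀ x, ‖F x‖ ≤ M)
    (x₀ : E) :
    ∃ x : ℝ → E, x 0 = x₀ ∧ ∀ t ∈ Ici (0 : ℝ), HasDerivWithinAt x (F (x t)) (Ici 0) t := by
  have hloc : ∀ n : ℕ, ∃ x : ℝ → E, x 0 = x₀ ∧
      ∀ t ∈ Icc (0 : ℝ) n, HasDerivWithinAt x (F (x t)) (Icc 0 (n : ℝ)) t := by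
    intro n
    -- Speed at most M confines the solution to radius M * n up to time n, and the Lipschitz bound
    -- holds on every ball.
    have hpl : IsPicardLindelof (fun _ => F) (tmin := 0) (tmax := n)
        ⟨0, le_rfl, Nat.cast_nonneg n⟩ x₀ (M * n) 0 M K := by
      refine .of_time_independent (fun x _ => hM x) hF.lipschitzOnWith ?_
      simp
    exact hpl.exists_eq_forall_mem_Icc_hasDerivWithinAt₀
  choose y hy0 hy using hloc
  have hright : ∀ n : ℕ, ∀ t ∈ Ico (0 : ℝ) n, HasDerivWithinAt (y n) (F (y n t)) (Ici t) t := by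
    intro n t ht
    refine ((hy n t (Ico_subset_Icc_self ht)).mono_of_mem_nhdsWithin ?_)
    exact Filter.mem_of_superset (Icc_mem_nhdsGE ht.2) (Icc_subset_Icc_left ht.1)
  have huniq : ∀ m n : ℕ, m ≤ n → EqOn (y m) (y n) (Icc 0 m) := by
    intro m n hmn
    have hmn' : (m : ℝ) ≤ n := Nat.cast_le.2 hmn
    refine ODE_solution_unique (v := fun _ => F) (fun _ => hF)
      (fun t ht => (hy m t ht).continuousWithinAt) (hright m)
      (fun t ht => ((hy n t ⟨ht.1, ht.2.trans hmn'⟩).continuousWithinAt).mono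
        (Icc_subset_Icc_right hmn'))
      (fun t ht => hright n t ⟨ht.1, ht.2.trans_le hmn'⟩) ?_
    rw [hy0, hy0]
  -- By uniqueness, choosing the solution on [0, ⌈t⌉] at each time t yields one coherent function.
  have hglue : ∀ n : ℕ, EqOn (fun t => y ⌈t⌉₊ t) (y n) (Icc 0 n) := fun n t ht =>
    huniq _ _ (Nat.ceil_le.2 ht.2) ⟨ht.1, Nat.le_ceil t⟩
  refine ⟨fun t => y ⌈t⌉₊ t, by simp [hy0], fun t ht => ?_⟩
  obtain ⟨n, hn⟩ := exists_nat_gt t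
  have hmem : t ∈ Icc (0 : ℝ) n := ⟨ht, hn.le⟩
  have h := (hy n t hmem).congr (hglue n) (hglue n hmem)
  rw [← hglue n hmem] at h
  refine h.mono_of_mem_nhdsWithin ?_
  rw [← Ici_inter_Iic]
  exact inter_mem_nhdsWithin _ (Iic_mem_nhds hn)

theorem lipschitzWith_mul_of_bounded {α : Type*} [PseudoMetricSpace α] {f g : α → ℝ}
    {Kf Kg A B : NNReal} (hf : LipschitzWith Kf f) (hg : LipschitzWith Kg g)
    (hA : ∀ x, |f x| ≤ A) (hB : ∀ x, |g x| ≤ B) :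
    LipschitzWith (A * Kg + B * Kf) fun x => f x * g x := by
  refine LipschitzWith.of_dist_le_mul fun x y => ?_
  have h1 := hf.dist_le_mul x y
  have h2 := hg.dist_le_mul x y
  rw [Real.dist_eq] at *
  calc |f x * g x - f y * g y| = |f x * (g x - g y) + g y * (f x - f y)| := by ring_nf
    _ ≤ |f x| * |g x - g y| + |g y| * |f x - f y| := by
        rw [← abs_mul, ← abs_mul]; exact abs_add_le _ _
    _ ≤ A * (Kg * dist x y) + B * (Kf * dist x y) := by
        gcongr
        · exact hA x
        · exact hB y
    _ = _ := by push_cast; ring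

theorem exists_lipschitzWith_bounded_pi {α ι : Type*} [PseudoMetricSpace α] [Fintype ι]
    {F : α → ι → ℝ}
    (h : ∀ i, ∃ K M : NNReal, LipschitzWith K (fun x => F x i) ∧ ∀ x, |F x i| ≤ M) :
    ∃ K M : NNReal, LipschitzWith K F ∧ ∀ x, ‖F x‖ ≤ M := by
  choose K M hK hM using h
  refine ⟨∑ i, K i, ∑ i, M i, ?_, fun x => ?_⟩
  · refine LipschitzWith.of_dist_le_mul fun x y => ?_
    refine (dist_pi_le_iff (by positivity)).2 fun i => ((hK i).dist_le_mul x y).trans ?_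
    gcongr
    exact Finset.single_le_sum (fun _ _ => zero_le) (Finset.mem_univ i)
  · refine (pi_norm_le_iff_of_nonneg (by positivity)).2 fun i => (hM i x).trans ?_
    exact_mod_cast Finset.single_le_sum (f := M) (fun _ _ => zero_le) (Finset.mem_univ i)

/-! ### The quadratic Lyapunov function. -/

section Energy

variable {I : Type*} [Fintype I]

/-- The quadratic form of a symmetric matrix at the displacement from `a`. -/
def energy (R : Matrix I I ℝ) (a x : I → ℝ) : ℝ := (x - a) ⬝ᵥ (R *ᵥ (x - a))

theorem HasDerivWithinAt.energy {R : Matrix I I ℝ} (hR : R.IsHermitian) {a v : I → ℝ}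
    {x : ℝ → I → ℝ} {s : Set ℝ} {t : ℝ} (h : ∀ i, HasDerivWithinAt (fun r => x r i) (v i) s t) :
    HasDerivWithinAt (fun r => _root_.energy R a (x r))
      (2 * ∑ i, v i * (R *ᵥ (x t - a)) i) s t := by
  have h1 : ∀ i, HasDerivWithinAt (fun r => (x r - a) i) (v i) s t := fun i => (h i).sub_const _
  have h2 : ∀ i, HasDerivWithinAt (fun r => (R *ᵥ (x r - a)) i) ((R *ᵥ v) i) s t := fun i =>
    HasDerivWithinAt.fun_sum fun j _ => (h1 j).const_mul (R i j)
  have h3 : HasDerivWithinAt (fun r => _root_.energy R a (x r)) _ s t :=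
    HasDerivWithinAt.fun_sum fun i _ => (h1 i).mul (h2 i)
  convert h3 using 1
  have hsymm : (x t - a) ⬝ᵥ (R *ᵥ v) = v ⬝ᵥ (R *ᵥ (x t - a)) := by
    rw [dotProduct_mulVec, ← mulVec_transpose, dotProduct_comm]
    rw [show Rᵀ = R from hR]
  rw [Finset.sum_add_distrib]
  simp only [dotProduct] at hsymm
  rw [hsymm]
  ring

/-- The third bound, which compares the energy with its squared gradient, turns dissipation into an
exponential rate. It holds because Rᵀ R is also positive definite. -/
theorem Matrix.PosDef.exists_energy_bounds {R : Matrix I I ℝ} (hR : R.PosDef) :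
    ∃ c > 0, ∃ C > 0, ∃ ρ > 0, ∀ a x : I → ℝ, c * ‖x - a‖ ^ 2 ≤ energy R a x ∧
      energy R a x ≤ C * ‖x - a‖ ^ 2 ∧
      ρ * energy R a x ≤ ∑ i, (R *ᵥ (x - a)) i ^ 2 := by
  classical
  obtain ⟨c, hc, hcb⟩ := hR.exists_mul_sq_norm_le
  obtain ⟨D, hD, hDb⟩ := R.exists_norm_mulVec_le
  have hRR : (Rᴴ * R).PosDef :=
    PosDef.conjTranspose_mul_self R (mulVec_injective_iff_isUnit.2 hR.isUnit)
  obtain ⟨e, he, heb⟩ := hRR.exists_mul_sq_norm_le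
  have hup : ∀ z : I → ℝ, z ⬝ᵥ (R *ᵥ z) ≤ (Fintype.card I * D + 1) * ‖z‖ ^ 2 := fun z =>
    calc z ⬝ᵥ (R *ᵥ z) ≤ Fintype.card I * (‖z‖ * ‖R *ᵥ z‖) := dotProduct_le_card_mul_norm _ _
      _ ≤ Fintype.card I * (‖z‖ * (D * ‖z‖)) := by gcongr; exact hDb z
      _ ≤ (Fintype.card I * D + 1) * ‖z‖ ^ 2 := by nlinarith [sq_nonneg ‖z‖]
  have hC : 0 < Fintype.card I * D + 1 := by positivity
  refine ⟨c, hc, _, hC, e / (Fintype.card I * D + 1), by positivity, fun a x =>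
    ⟨hcb _, hup _, ?_⟩⟩
  calc _ ≤ e / (Fintype.card I * D + 1) * ((Fintype.card I * D + 1) * ‖x - a‖ ^ 2) := by
        gcongr; exact hup _
    _ = e * ‖x - a‖ ^ 2 := by field_simp
    _ ≤ _ := heb _
    _ = ∑ i, (R *ᵥ (x - a)) i ^ 2 := by
        rw [← mulVec_mulVec, dotProduct_mulVec, vecMul_conjTranspose, star_trivial, star_trivial]
        simp [dotProduct, sq]

end Energy

/-! ### Decay and existence for the Lotka-Volterra system. -/

section ReducedSystem

variable {I : Type*} [Fintype I]

/-- `x` is a solution on `s` of the Lotka-Volterra system `τ i * x i' = - x i * (R (x - a)) i`. -/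
def IsReducedSolutionOn (τ : I → ℝ) (R : Matrix I I ℝ) (a : I → ℝ) (s : Set ℝ)
    (x : ℝ → I → ℝ) : Prop :=
  ∀ t ∈ s, (∀ i, 0 < x t i) ∧ ∀ i, ∃ v : ℝ, HasDerivWithinAt (fun r => x r i) v s t ∧
    τ i * v = - x t i * (R *ᵥ (x t - a)) i

variable {τ : I → ℝ} {R : Matrix I I ℝ} {a : I → ℝ}

/-- Grönwall with an integrating factor. The case r = 0 gives plain monotonicity of the energy,
which traps trajectories before any rate is known. -/
theorem antitoneOn_exp_mul_energy (hR : R.IsHermitian) {x v : ℝ → I → ℝ} {s : Set ℝ}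
    (hs : Convex ℝ s) (hx : ∀ t ∈ s, ∀ i, HasDerivWithinAt (fun r => x r i) (v t i) s t) {r : ℝ}
    (hv : ∀ t ∈ s, ∑ i, v t i * (R *ᵥ (x t - a)) i ≤ - r * energy R a (x t)) :
    AntitoneOn (fun t => Real.exp (2 * r * t) * energy R a (x t)) s := by
  have hd : ∀ t ∈ s, HasDerivWithinAt (fun t => Real.exp (2 * r * t) * energy R a (x t))
      (Real.exp (2 * r * t) * (2 * r * 1) * energy R a (x t) +
        Real.exp (2 * r * t) * (2 * ∑ i, v t i * (R *ᵥ (x t - a)) i)) s t := fun t ht =>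
    ((((hasDerivAt_id t).const_mul (2 * r)).exp).hasDerivWithinAt).mul
      (HasDerivWithinAt.energy hR (hx t ht))
  refine antitoneOn_of_hasDerivWithinAt_nonpos hs (fun t ht => (hd t ht).continuousWithinAt)
    (fun t ht => (hd t (interior_subset ht)).mono interior_subset) fun t ht => ?_
  have := hv t (interior_subset ht)
  have he := Real.exp_pos (2 * r * t)
  nlinarith

theorem norm_sub_le_of_energy_le {c C r t : ℝ} (hc : 0 < c) (hC : 0 < C) {x y : I → ℝ}
    (hx : c * ‖x - a‖ ^ 2 ≤ energy R a x) (hy : energy R a y ≤ C * ‖y - a‖ ^ 2)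
    (h : Real.exp (2 * r * t) * energy R a x ≤ energy R a y) :
    ‖x - a‖ ≤ Real.sqrt (C / c) * Real.exp (- r * t) * ‖y - a‖ := by
  refine le_of_sq_le_sq ?_ (by positivity)
  rw [mul_pow, mul_pow, Real.sq_sqrt (by positivity), ← Real.exp_nat_mul,
    show ((2 : ℕ) : ℝ) * (-r * t) = -(2 * r * t) by push_cast; ring, Real.exp_neg]
  have he := Real.exp_pos (2 * r * t)
  have h1 : Real.exp (2 * r * t) * (c * ‖x - a‖ ^ 2) ≤ C * ‖y - a‖ ^ 2 :=
    (mul_le_mul_of_nonneg_left hx he.le).trans (h.trans hy)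
  calc ‖x - a‖ ^ 2 = (Real.exp (2 * r * t) * (c * ‖x - a‖ ^ 2)) / (Real.exp (2 * r * t) * c) := by
        field_simp
    _ ≤ (C * ‖y - a‖ ^ 2) / (Real.exp (2 * r * t) * c) := by gcongr
    _ = _ := by field_simp

theorem exists_forall_le_of_pos [Nonempty I] (ha : ∀ i, 0 < a i) : ∃ ε > 0, ∀ i, ε ≤ a i := by
  obtain ⟨i, hi⟩ := Finite.exists_min a
  exact ⟨a i, ha i, hi⟩

theorem exists_exponential_decay [Nonempty I] (hτ : ∀ i, 0 < τ i) (hR : R.PosDef)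
    (ha : ∀ i, 0 < a i) :
    ∃ δ > 0, ∃ c > 0, ∃ r > 0, ∀ T > 0, ∀ x, IsReducedSolutionOn τ R a (Ico 0 T) x →
      ‖x 0 - a‖ < δ → ∀ t ∈ Ico 0 T, ‖x t - a‖ ≤ c * Real.exp (- r * t) * ‖x 0 - a‖ := by
  obtain ⟨c, hc, C, hC, ρ, hρ, hb⟩ := hR.exists_energy_bounds
  obtain ⟨ε, hε, hεa⟩ := exists_forall_le_of_pos ha
  -- While x stays within ε / 2 of a, every x_i is at least ε / 2, so k bounds each x_i / τ_i from
  -- below.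
  obtain ⟨k, hk, hkτ⟩ := exists_forall_le_of_pos (a := fun i => ε / 2 / τ i)
    fun i => div_pos (half_pos hε) (hτ i)
  have hD : 0 < Real.sqrt (C / c) := by positivity
  refine ⟨ε / 2 / Real.sqrt (C / c), by positivity, Real.sqrt (C / c), hD, k * ρ, by positivity,
    fun T hT x hx hδ => ?_⟩
  have h0 : (0 : ℝ) ∈ Ico 0 T := ⟨le_rfl, hT⟩
  choose! v hv hv' using fun t ht => (hx t ht).2
  have hveq : ∀ t ∈ Ico 0 T, ∀ i, v t i * (R *ᵥ (x t - a)) i =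
      - (x t i / τ i * (R *ᵥ (x t - a)) i ^ 2) := by
    intro t ht i
    have hvi : v t i = - x t i * (R *ᵥ (x t - a)) i / τ i := by
      rw [← hv' t ht i, mul_div_cancel_left₀ _ (hτ i).ne']
    rw [hvi]
    ring
  -- Positivity of x alone makes the energy nonincreasing, so no continuation argument is needed.
  have hnear : ∀ t ∈ Ico 0 T, ‖x t - a‖ ≤ ε / 2 := by
    intro t ht
    have hanti := antitoneOn_exp_mul_energy (a := a) (r := 0) hR.1 (convex_Ico 0 T) hv
      fun t ht => by
        rw [neg_zero, zero_mul]
        refine Finset.sum_nonpos fun i _ => ?_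
        rw [hveq t ht i, neg_nonpos]
        exact mul_nonneg (div_nonneg ((hx t ht).1 i).le (hτ i).le) (sq_nonneg _)
    have h := norm_sub_le_of_energy_le hc hC (hb a (x t)).1 (hb a (x 0)).2.1 (r := 0) (t := t)
      (by simpa using hanti h0 ht ht.1)
    simp only [neg_zero, zero_mul, Real.exp_zero, mul_one] at h
    rw [lt_div_iff₀' hD] at hδ
    exact h.trans hδ.le
  intro t ht
  have hanti := antitoneOn_exp_mul_energy (a := a) (r := k * ρ) hR.1 (convex_Ico 0 T) hv
    fun t ht => by
      rw [Finset.sum_congr rfl fun i _ => hveq t ht i, Finset.sum_neg_distrib, neg_mul, neg_le_neg_iff,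
        mul_assoc]
      calc k * (ρ * energy R a (x t)) ≤ k * ∑ i, (R *ᵥ (x t - a)) i ^ 2 := by
            gcongr; exact (hb a (x t)).2.2
        _ = ∑ i, k * (R *ᵥ (x t - a)) i ^ 2 := Finset.mul_sum _ _ _
        _ ≤ _ := Finset.sum_le_sum fun i _ => by
            refine mul_le_mul_of_nonneg_right ((hkτ i).trans ?_) (sq_nonneg _)
            refine div_le_div_of_nonneg_right ?_ (hτ i).le
            have h1 := (norm_le_pi_norm (x t - a) i).trans (hnear t ht)
            rw [Real.norm_eq_abs, Pi.sub_apply] at h1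
            linarith [(abs_le.1 h1).1, hεa i]
  refine norm_sub_le_of_energy_le hc hC (hb a (x t)).1 (hb a (x 0)).2.1 ?_
  simpa using hanti h0 ht ht.1

/-- Truncation of a real number to the interval `[l, u]`. -/
def truncate (l u y : ℝ) : ℝ := max l (min u y)

theorem lipschitzWith_truncate (l u : ℝ) : LipschitzWith 1 (truncate l u) :=
  (LipschitzWith.id.const_min u).const_max l

theorem truncate_of_mem {l u y : ℝ} (hl : l ≤ y) (hu : y ≤ u) : truncate l u y = y := by
  simp [truncate, hl, hu]

theorem abs_truncate_le {l u : ℝ} (hlu : |l| ≤ u) (y : ℝ) : |truncate l u y| ≤ u :=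
  abs_le.2 ⟨(abs_le.1 hlu).1.trans (le_max_left _ _),
    max_le (abs_le.1 hlu).2 (min_le_left _ _)⟩

theorem truncate_mul_self_nonneg {u : ℝ} (hu : 0 ≤ u) (y : ℝ) : 0 ≤ truncate (-u) u y * y := by
  rcases le_total 0 y with h | h
  · exact mul_nonneg (le_max_of_le_right (le_min hu h)) h
  · exact mul_nonneg_of_nonpos_of_nonpos (max_le (by linarith) ((min_le_right _ _).trans h)) h

/-- A bounded, globally Lipschitz modification of the vector field of the reduced system. -/
noncomputable def truncatedField (τ : I → ℝ) (R : Matrix I I ℝ) (a x : I → ℝ) (i : I) : ℝ :=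
  (- truncate 0 (2 * a i) (x i) / τ i) * truncate (-1) 1 ((R *ᵥ (x - a)) i)

theorem exists_lipschitzWith_truncatedField (ha : ∀ i, 0 < a i) :
    ∃ K M : NNReal, LipschitzWith K (truncatedField τ R a) ∧ ∀ x, ‖truncatedField τ R a x‖ ≤ M := by
  refine exists_lipschitzWith_bounded_pi fun i => ?_
  obtain ⟨D, hD, hDb⟩ := R.exists_norm_mulVec_le
  have h2a : 0 ≤ 2 * a i := by linarith [ha i]
  have hf : LipschitzWith (Real.toNNReal |(τ i)⁻¹|)
      fun x : I → ℝ => - truncate 0 (2 * a i) (x i) / τ i := by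
    refine LipschitzWith.of_dist_le_mul fun x y => ?_
    have h := (lipschitzWith_truncate 0 (2 * a i)).dist_le_mul (x i) (y i)
    rw [NNReal.coe_one, one_mul, Real.dist_eq] at h
    rw [Real.coe_toNNReal _ (abs_nonneg _), Real.dist_eq, show
      -truncate 0 (2 * a i) (x i) / τ i - -truncate 0 (2 * a i) (y i) / τ i =
        (τ i)⁻¹ * (-(truncate 0 (2 * a i) (x i) - truncate 0 (2 * a i) (y i))) by ring, abs_mul,
      abs_neg]
    gcongr
    exact h.trans (dist_le_pi_dist x y i)
  have hg : LipschitzWith (1 * Real.toNNReal D)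
      fun x : I → ℝ => truncate (-1) 1 ((R *ᵥ (x - a)) i) := by
    refine (lipschitzWith_truncate (-1) 1).comp (LipschitzWith.of_dist_le_mul fun x y => ?_)
    rw [Real.coe_toNNReal _ hD.le, dist_eq_norm, dist_eq_norm, ← Pi.sub_apply, ← mulVec_sub,
      sub_sub_sub_cancel_right]
    exact (norm_le_pi_norm _ i).trans (hDb _)
  have hA : ∀ x : I → ℝ, |- truncate 0 (2 * a i) (x i) / τ i| ≤
      Real.toNNReal (2 * a i * |(τ i)⁻¹|) := fun x => by
    rw [Real.coe_toNNReal _ (by positivity), div_eq_mul_inv, abs_mul, abs_neg]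
    gcongr
    exact abs_truncate_le (by simpa using h2a) _
  have hB : ∀ x : I → ℝ, |truncate (-1) 1 ((R *ᵥ (x - a)) i)| ≤ (1 : NNReal) := fun x =>
    abs_truncate_le (by simp) _
  refine ⟨_, Real.toNNReal (2 * a i * |(τ i)⁻¹|) * 1,
    lipschitzWith_mul_of_bounded hf hg hA hB, fun x => ?_⟩
  rw [truncatedField, abs_mul, NNReal.coe_mul]
  exact mul_le_mul (hA x) (hB x) (abs_nonneg _) (NNReal.coe_nonneg _)

/-- Truncation preserves the signs that make the energy nonincreasing. A trajectory of the truncated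
field starting near a thus stays where the truncations are inactive, and solves the original system.
-/
theorem exists_isReducedSolutionOn_Ici [Nonempty I] (hτ : ∀ i, 0 < τ i) (hR : R.PosDef)
    (ha : ∀ i, 0 < a i) {η : ℝ} (hη : 0 < η) :
    ∃ δ > 0, ∀ x₀, ‖x₀ - a‖ < δ → ∃ x, x 0 = x₀ ∧ IsReducedSolutionOn τ R a (Ici 0) x ∧
      ∀ t ∈ Ici (0 : ℝ), ‖x t - a‖ < η := by
  obtain ⟨c, hc, C, hC, _, _, hb⟩ := hR.exists_energy_bounds
  obtain ⟨ε, hε, hεa⟩ := exists_forall_le_of_pos ha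
  obtain ⟨D, hD, hDb⟩ := R.exists_norm_mulVec_le
  obtain ⟨K, M, hK, hM⟩ := exists_lipschitzWith_truncatedField (τ := τ) (R := R) ha
  have hS : 0 < Real.sqrt (C / c) := by positivity
  -- The bound ε gives 0 < x_i < 2 a_i and D⁻¹ gives |(R (x - a))_i| ≤ 1, so neither truncation
  -- acts; η is the requested closeness.
  set θ := min (min η ε) D⁻¹ with hθ
  have hθ0 : 0 < θ := by positivity
  refine ⟨θ / Real.sqrt (C / c), by positivity, fun x₀ hx₀ => ?_⟩
  obtain ⟨x, rfl, hx⟩ := exists_forall_nonneg_hasDerivWithinAt hK hM x₀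
  have hxi := fun t ht => hasDerivWithinAt_pi.1 (hx t ht)
  have hnear : ∀ t ∈ Ici (0 : ℝ), ‖x t - a‖ < θ := by
    intro t ht
    have hanti := antitoneOn_exp_mul_energy (a := a) (r := 0) hR.1 (convex_Ici 0) hxi
      fun t ht => by
        rw [neg_zero, zero_mul]
        refine Finset.sum_nonpos fun i _ => ?_
        rw [truncatedField, mul_assoc, neg_div, neg_mul, neg_nonpos]
        exact mul_nonneg (div_nonneg (le_max_left _ _) (hτ i).le)
          (truncate_mul_self_nonneg zero_le_one _)
    have h := norm_sub_le_of_energy_le hc hC (hb a (x t)).1 (hb a (x 0)).2.1 (r := 0) (t := t)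
      (by simpa using hanti self_mem_Ici ht ht)
    simp only [neg_zero, zero_mul, Real.exp_zero, mul_one] at h
    rw [lt_div_iff₀' hS] at hx₀
    exact h.trans_lt hx₀
  refine ⟨x, rfl, fun t ht => ?_, fun t ht =>
    (hnear t ht).trans_le ((min_le_left _ _).trans (min_le_left _ _))⟩
  have hcoord : ∀ i, |x t i - a i| < a i := fun i =>
    ((norm_le_pi_norm (x t - a) i).trans_lt (hnear t ht)).trans_le
      (((min_le_left _ _).trans (min_le_right _ _)).trans (hεa i))
  have hpos : ∀ i, 0 < x t i := fun i => by linarith [(abs_lt.1 (hcoord i)).1]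
  refine ⟨hpos, fun i => ⟨_, hxi t ht i, ?_⟩⟩
  have hRi : |(R *ᵥ (x t - a)) i| ≤ 1 := calc
    |(R *ᵥ (x t - a)) i| ≤ ‖R *ᵥ (x t - a)‖ := norm_le_pi_norm (R *ᵥ (x t - a)) i
    _ ≤ D * ‖x t - a‖ := hDb _
    _ ≤ D * D⁻¹ := by gcongr; exact (hnear t ht).le.trans (min_le_right _ _)
    _ = 1 := mul_inv_cancel₀ hD.ne'
  rw [truncatedField, truncate_of_mem (hpos i).le (by linarith [(abs_lt.1 (hcoord i)).2]),
    truncate_of_mem (abs_le.1 hRi).1 (abs_le.1 hRi).2]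
  have := (hτ i).ne'
  field_simp

end ReducedSystem

/-! ### Kron reduction and sums over edges. -/

/-- Kron reduction: eliminating the first block of coordinates of a positive definite matrix. -/
theorem Matrix.PosDef.exists_kron_reduction {L I : Type*} [Fintype L] [Fintype I] [DecidableEq L]
    [DecidableEq I] {A : Matrix (L ⊕ I) (L ⊕ I) ℝ} (hA : A.PosDef) :
    ∃ (G : Matrix L I ℝ) (R : Matrix I I ℝ), R.PosDef ∧
      (∀ y x, (∀ i, (A *ᵥ Sum.elim y x) (Sum.inl i) = 0) ↔ y = G *ᵥ x) ∧
      ∀ x i, (A *ᵥ Sum.elim (G *ᵥ x) x) (Sum.inr i) = (R *ᵥ x) i := by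
  have hLL : A.toBlocks₁₁.PosDef := hA.submatrix Sum.inl_injective
  have hU := (isUnit_iff_isUnit_det _).1 hLL.isUnit
  set G : Matrix L I ℝ := -(A.toBlocks₁₁⁻¹ * A.toBlocks₁₂) with hG
  have hinl : ∀ y x i, (A *ᵥ Sum.elim y x) (Sum.inl i) =
      (A.toBlocks₁₁ *ᵥ y + A.toBlocks₁₂ *ᵥ x) i := fun y x i => by
    conv_lhs => rw [← fromBlocks_toBlocks A, fromBlocks_mulVec]
    rfl
  have hload : ∀ y x, (∀ i, (A *ᵥ Sum.elim y x) (Sum.inl i) = 0) ↔ y = G *ᵥ x := by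
    intro y x
    simp only [hinl]
    rw [hG, neg_mulVec, ← mulVec_mulVec]
    constructor
    · intro h
      have h' : A.toBlocks₁₁ *ᵥ y = -(A.toBlocks₁₂ *ᵥ x) := eq_neg_of_add_eq_zero_left (funext h)
      rw [← mulVec_neg, ← h', mulVec_mulVec, nonsing_inv_mul _ hU, one_mulVec]
    · rintro rfl i
      rw [mulVec_neg, mulVec_mulVec, mul_nonsing_inv _ hU, one_mulVec, neg_add_cancel]
      rfl
  -- P parametrizes the solutions of the load equations. R = Pᵀ A P is definite since P is
  -- injective, and Pᵀ reads off the second block of any vector vanishing on the first.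
  set P : Matrix (L ⊕ I) I ℝ := fromRows G 1 with hP
  have hPx : ∀ x, P *ᵥ x = Sum.elim (G *ᵥ x) x := fun x => by
    rw [hP, fromRows_mulVec, one_mulVec]
  refine ⟨G, Pᴴ * A * P, hA.conjTranspose_mul_mul_same fun x y h => ?_, hload, fun x i => ?_⟩
  · rw [hPx, hPx] at h
    exact funext fun i => congrFun h (Sum.inr i)
  · rw [← mulVec_mulVec, ← mulVec_mulVec, hPx]
    have h0 := (hload (G *ᵥ x) x).2 rfl
    have hPi : ∀ w : L ⊕ I → ℝ, (∀ i, w (Sum.inl i) = 0) → (Pᴴ *ᵥ w) i = w (Sum.inr i) := by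
      intro w hw
      simp [hP, mulVec, dotProduct, hw, one_apply]
    exact (hPi _ h0).symm

theorem Matrix.IsHermitian.dotProduct_mulVec_comm {ι : Type*} [Fintype ι] {A : Matrix ι ι ℝ}
    (hA : A.IsHermitian) (x y : ι → ℝ) : x ⬝ᵥ (A *ᵥ y) = y ⬝ᵥ (A *ᵥ x) := by
  rw [dotProduct_mulVec, ← mulVec_transpose, dotProduct_comm, show Aᵀ = A from hA]

/-- Each edge is counted by exactly its two orientations. -/
theorem SimpleGraph.sum_sum_adj_eq_two_mul {V : Type*} [Fintype V] [DecidableEq V]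
    (G : SimpleGraph V) [DecidableRel G.Adj] [Fintype G.edgeSet] (f : Sym2 V → ℝ) :
    ∑ i, ∑ j, (if G.Adj i j then f s(i, j) else 0) = 2 * ∑ e ∈ G.edgeFinset, f e := by
  rw [← Fintype.sum_prod_type', ← Finset.sum_filter, Finset.mul_sum,
    ← Finset.sum_fiberwise_of_maps_to (t := G.edgeFinset) (g := fun p : V × V => s(p.1, p.2))]
  · refine Finset.sum_congr rfl fun e he => ?_
    induction e with | h a b =>
    have hab : G.Adj a b := by simpa using he
    have : (Finset.univ.filter fun p : V × V => G.Adj p.1 p.2).filter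
        (fun p => s(p.1, p.2) = s(a, b)) = {(a, b), (b, a)} := by
      ext ⟨u, v⟩
      simp only [Finset.mem_filter, Finset.mem_univ, true_and, Sym2.eq_iff, Finset.mem_insert,
        Finset.mem_singleton, Prod.mk.injEq]
      constructor
      · exact fun h => h.2
      · rintro (⟨rfl, rfl⟩ | ⟨rfl, rfl⟩)
        · exact ⟨hab, .inl ⟨rfl, rfl⟩⟩
        · exact ⟨hab.symm, .inr ⟨rfl, rfl⟩⟩
    rw [this, Finset.sum_pair (by simp [hab.ne]), Sym2.eq_swap (a := b)]
    ring
  · intro p hp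
    simpa using hp

/-! ### The susceptance Laplacian and definiteness of the stiffness matrix. -/

namespace Microgrid

variable {L I : Type*} [Fintype L] [Fintype I] [DecidableEq L] [DecidableEq I]

theorem B_of_ne (N : Microgrid L I) {i j : L ⊕ I} (h : i ≠ j) : N.B i j = - N.b i j := by
  simp [B, h]

theorem B_nonneg (N : Microgrid L I) {i j : L ⊕ I} (h : i ≠ j) : 0 ≤ N.B i j := by
  rw [N.B_of_ne h]
  by_cases hadj : N.graph.Adj i j
  · linarith [N.b_neg i j hadj]
  · simp [N.b_zero i j hadj]

theorem B_pos (N : Microgrid L I) {i j : L ⊕ I} (h : N.graph.Adj i j) : 0 < N.B i j := by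
  rw [N.B_of_ne h.ne]
  linarith [N.b_neg i j h]

theorem sum_B (N : Microgrid L I) (i : L ⊕ I) : ∑ j, N.B i j = 0 := by
  rw [← Finset.add_sum_erase _ _ (Finset.mem_univ i),
    Finset.sum_congr rfl fun j hj => N.B_of_ne (Finset.ne_of_mem_erase hj).symm]
  simp [B]

/-- The rows and columns of B sum to zero, so only the cross terms of the expanded squares survive.
-/
theorem sum_sum_B_mul_sub_sq (N : Microgrid L I) (E : L ⊕ I → ℝ) :
    ∑ i, ∑ j, N.B i j * (E i - E j) ^ 2 = - 2 * E ⬝ᵥ (N.B *ᵥ E) := by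
  have h1 : ∑ i, ∑ j, N.B i j * E i ^ 2 = 0 := by
    simp [← Finset.sum_mul, N.sum_B]
  have h2 : ∑ i, ∑ j, N.B i j * E j ^ 2 = 0 := by
    rw [Finset.sum_comm]
    calc _ = ∑ j, ∑ i, N.B j i * E j ^ 2 :=
          Finset.sum_congr rfl fun j _ => Finset.sum_congr rfl fun i _ => by rw [N.B_symm]
      _ = 0 := h1
  calc _ = ∑ i, ∑ j, N.B i j * E i ^ 2 + ∑ i, ∑ j, N.B i j * E j ^ 2
        - 2 * ∑ i, ∑ j, E i * (N.B i j * E j) := by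
        simp only [Finset.mul_sum, ← Finset.sum_add_distrib, ← Finset.sum_sub_distrib]
        exact Finset.sum_congr rfl fun i _ => Finset.sum_congr rfl fun j _ => by ring
    _ = _ := by
        rw [h1, h2]
        simp only [dotProduct, mulVec, ← Finset.mul_sum]
        simp

theorem Qloss_eq (N : Microgrid L I) (E : L ⊕ I → ℝ) : N.Qloss E = - E ⬝ᵥ (N.B *ᵥ E) := by
  classical
  have h := N.graph.sum_sum_adj_eq_two_mul
    (Sym2.lift ⟨fun i j => N.B i j * (E i - E j) ^ 2, fun i j => by
      change N.B i j * (E i - E j) ^ 2 = N.B j i * (E j - E i) ^ 2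
      rw [N.B_symm i j]; ring⟩)
  have h2 : ∀ i j, (if N.graph.Adj i j then N.B i j * (E i - E j) ^ 2 else 0) =
      N.B i j * (E i - E j) ^ 2 := fun i j => by
    split_ifs with hadj
    · rfl
    · rcases eq_or_ne i j with rfl | hij
      · simp
      · simp [N.B_of_ne hij, N.b_zero i j hadj]
  simp only [Sym2.lift_mk, h2] at h
  rw [N.sum_sum_B_mul_sub_sq] at h
  rw [Qloss, neg_dotProduct]
  linarith

/-- Half the Hessian of the total cost: the weighted graph Laplacian of the network, shifted by the
shunt loads and the controller gains. -/
def stiffness (N : Microgrid L I) (bshunt : L → ℝ) : Matrix (L ⊕ I) (L ⊕ I) ℝ :=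
  -(N.B + diagonal (Sum.elim bshunt N.K))

/-- The linear part of the total cost, up to a factor of `-2`. -/
def drive (N : Microgrid L I) : L ⊕ I → ℝ := Sum.elim 0 fun i => - N.K i * N.Eset i

variable (N : Microgrid L I) (bshunt : L → ℝ)

theorem stiffness_mulVec (E : L ⊕ I → ℝ) (i : L ⊕ I) :
    (N.stiffness bshunt *ᵥ E) i = -((N.B *ᵥ E) i + Sum.elim bshunt N.K i * E i) := by
  simp [stiffness, neg_mulVec, add_mulVec, mulVec_diagonal]

theorem isHermitian_stiffness : (N.stiffness bshunt).IsHermitian := by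
  refine ((IsHermitian.ext fun i j => ?_).add (isHermitian_diagonal _)).neg
  rw [star_trivial, N.B_symm]

theorem stiffness_of_ne {i j : L ⊕ I} (h : i ≠ j) : N.stiffness bshunt i j = - N.B i j := by
  simp [stiffness, h]

theorem BIL_eq : N.BIL = N.BLIᵀ := by
  ext i j
  exact N.B_symm (Sum.inr i) (Sum.inl j)

theorem stiffness_eq_fromBlocks : N.stiffness bshunt =
    fromBlocks (-(N.BLL + diagonal bshunt)) (-N.BLI) (-N.BIL) (-(N.BII + N.KI)) := by
  ext (i | i) (j | j) <;>
    simp [stiffness, BLL, BLI, BIL, BII, KI, toBlocks₁₁, toBlocks₁₂, toBlocks₂₁, toBlocks₂₂,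
      diagonal_apply, neg_ite]

/-- The form is a sum of branch terms and gain terms, all nonnegative. If it vanishes, x is constant
by connectedness and zero at an inverter. -/
theorem posDef_stiffness_zero [Nonempty I] : (N.stiffness 0).PosDef := by
  refine .of_dotProduct_mulVec_pos (N.isHermitian_stiffness 0) fun x hx => ?_
  have hexp : star x ⬝ᵥ (N.stiffness 0 *ᵥ x) =
      1 / 2 * ∑ i, ∑ j, N.B i j * (x i - x j) ^ 2 + ∑ i, -(N.K i * x (Sum.inr i) ^ 2) := by
    rw [N.sum_sum_B_mul_sub_sq]
    simp only [star_trivial, stiffness, neg_mulVec, add_mulVec, dotProduct_neg, dotProduct_add]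
    have : x ⬝ᵥ (diagonal (Sum.elim 0 N.K) *ᵥ x) = ∑ i, N.K i * x (Sum.inr i) ^ 2 := by
      simp only [dotProduct, mulVec_diagonal, Fintype.sum_sum_type, Sum.elim_inl, Sum.elim_inr,
        Pi.zero_apply, zero_mul, mul_zero, Finset.sum_const_zero, zero_add]
      exact Finset.sum_congr rfl fun i _ => by ring
    rw [this, Finset.sum_neg_distrib]
    ring
  have hterm : ∀ i j, 0 ≤ N.B i j * (x i - x j) ^ 2 := fun i j => by
    rcases eq_or_ne i j with rfl | hij
    · simp
    · exact mul_nonneg (N.B_nonneg hij) (sq_nonneg _)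
  have hinner : ∀ i, 0 ≤ ∑ j, N.B i j * (x i - x j) ^ 2 := fun i =>
    Finset.sum_nonneg fun j _ => hterm i j
  have hK : ∀ i, 0 ≤ -(N.K i * x (Sum.inr i) ^ 2) := fun i => by
    nlinarith [N.K_neg i, sq_nonneg (x (Sum.inr i))]
  have h1 : 0 ≤ ∑ i, ∑ j, N.B i j * (x i - x j) ^ 2 := Finset.sum_nonneg fun i _ => hinner i
  have h2 : 0 ≤ ∑ i, -(N.K i * x (Sum.inr i) ^ 2) := Finset.sum_nonneg fun i _ => hK i
  rw [hexp]
  by_contra! hle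
  have h1' : ∑ i, ∑ j, N.B i j * (x i - x j) ^ 2 = 0 := by linarith
  have h2' : ∑ i, -(N.K i * x (Sum.inr i) ^ 2) = 0 := by linarith
  have hadj : ∀ u w, N.graph.Adj u w → x u = x w := fun u w h => by
    have := (Finset.sum_eq_zero_iff_of_nonneg fun i _ => hinner i).1 h1' u (Finset.mem_univ u)
    have := (Finset.sum_eq_zero_iff_of_nonneg fun j _ => hterm u j).1 this w (Finset.mem_univ w)
    rcases mul_eq_zero.1 this with h0 | h0
    · exact absurd h0 (N.B_pos h).ne'
    · linarith [pow_eq_zero_iff two_ne_zero |>.1 h0]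
  have hconst : ∀ u w, x u = x w := fun u w => by
    obtain ⟨p⟩ := N.connected.preconnected u w
    induction p with
    | nil => rfl
    | cons h _ ih => exact (hadj _ _ h).trans ih
  obtain ⟨k⟩ := ‹Nonempty I›
  have hk := (Finset.sum_eq_zero_iff_of_nonneg fun i _ => hK i).1 h2' k (Finset.mem_univ k)
  have hxk : x (Sum.inr k) = 0 := by
    rcases mul_eq_zero.1 (neg_eq_zero.1 hk) with h0 | h0
    · exact absurd h0 (N.K_neg k).ne
    · exact pow_eq_zero_iff two_ne_zero |>.1 h0
  exact hx (funext fun u => (hconst u _).trans hxk)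

theorem posDef_neg_BII_add_KI [Nonempty I] : (-(N.BII + N.KI)).PosDef := by
  have h : ((N.stiffness 0).submatrix Sum.inr Sum.inr).PosDef :=
    N.posDef_stiffness_zero.submatrix Sum.inr_injective
  rw [stiffness_eq_fromBlocks] at h
  exact h

theorem isUnit_BII_add_KI [Nonempty I] : IsUnit (N.BII + N.KI) :=
  (IsUnit.neg_iff _).1 N.posDef_neg_BII_add_KI.isUnit

/-- The right-hand matrix is the Schur complement of the inverter block. Taking `bshunt` = 0 also
yields invertibility and symmetry of `Bred`. -/
theorem posDef_stiffness_iff [Nonempty I] :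
    (N.stiffness bshunt).PosDef ↔ (-(N.Bred + diagonal bshunt)).PosDef := by
  have h := posDef_fromBlocks₂₂_iff (-(N.BLL + diagonal bshunt)) (-N.BLI) N.posDef_neg_BII_add_KI
  rw [transpose_neg, ← BIL_eq, ← stiffness_eq_fromBlocks] at h
  rw [h]
  have hinv : (-(N.BII + N.KI))⁻¹ = -(N.BII + N.KI)⁻¹ := by
    refine inv_eq_left_inv ?_
    rw [neg_mul_neg, nonsing_inv_mul _ ((isUnit_iff_isUnit_det _).1 N.isUnit_BII_add_KI)]
  rw [hinv, Bred]
  simp only [Matrix.neg_mul, Matrix.mul_neg, neg_neg]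
  congr! 1
  abel

theorem isHermitian_Bred_add_diagonal [Nonempty I] :
    (-(N.Bred + diagonal bshunt)).IsHermitian := by
  have h : (-(N.Bred + diagonal 0)).IsHermitian :=
    ((N.posDef_stiffness_iff 0).1 N.posDef_stiffness_zero).1
  convert h.sub (isHermitian_diagonal bshunt) using 1
  simp [sub_eq_add_neg, add_comm]

theorem isUnit_Bred [Nonempty I] : IsUnit N.Bred := by
  have h := ((N.posDef_stiffness_iff 0).1 N.posDef_stiffness_zero).isUnit
  rw [IsUnit.neg_iff] at h
  simpa using h

/-! ### Equilibria and minimizers as solutions of one linear system. -/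

theorem loadResidual_constantImpedance (E : L ⊕ I → ℝ) (i : L) :
    N.loadResidual (constantImpedance bshunt) E i =
      - (E (Sum.inl i) * (N.stiffness bshunt *ᵥ E) (Sum.inl i)) := by
  rw [stiffness_mulVec]
  simp only [loadResidual, constantImpedance, Qe, mulVec, dotProduct, Sum.elim_inl]
  ring

theorem droopInput_eq (E : L ⊕ I → ℝ) (i : I) :
    N.droopInput E i =
      E (Sum.inr i) * (N.drive (Sum.inr i) - (N.stiffness bshunt *ᵥ E) (Sum.inr i)) := by
  rw [stiffness_mulVec]
  simp only [droopInput, drive, Qe, mulVec, dotProduct, Sum.elim_inr]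
  ring

theorem isConsistent_iff (E : L ⊕ I → ℝ) :
    N.IsConsistent (constantImpedance bshunt) E ↔
      E ∈ positiveVoltages (L ⊕ I) ∧ ∀ i, (N.stiffness bshunt *ᵥ E) (Sum.inl i) = 0 := by
  refine and_congr_right fun hE => forall_congr' fun i => ?_
  rw [loadResidual_constantImpedance, neg_eq_zero, mul_eq_zero, or_iff_right (hE _).ne']

theorem isEquilibrium_iff (E : L ⊕ I → ℝ) :
    N.IsEquilibrium (constantImpedance bshunt) E ↔
      E ∈ positiveVoltages (L ⊕ I) ∧ N.stiffness bshunt *ᵥ E = N.drive := by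
  rw [IsEquilibrium, isConsistent_iff, and_assoc]
  refine and_congr_right fun hE => ?_
  rw [funext_iff, Sum.forall]
  refine and_congr (forall_congr' fun i => Iff.rfl) (forall_congr' fun i => ?_)
  rw [N.droopInput_eq bshunt, mul_eq_zero, or_iff_right (hE _).ne', sub_eq_zero, eq_comm]

theorem cost_eq (E : L ⊕ I → ℝ) :
    N.cost bshunt N.K E = E ⬝ᵥ (N.stiffness bshunt *ᵥ E) - 2 * E ⬝ᵥ N.drive
      - ∑ i, N.K i * N.Eset i ^ 2 := by
  have h1 : E ⬝ᵥ (N.stiffness bshunt *ᵥ E) = - E ⬝ᵥ (N.B *ᵥ E)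
      - ∑ i, bshunt i * E (Sum.inl i) ^ 2 - ∑ i, N.K i * E (Sum.inr i) ^ 2 := by
    have : E ⬝ᵥ (diagonal (Sum.elim bshunt N.K) *ᵥ E) =
        ∑ i, bshunt i * E (Sum.inl i) ^ 2 + ∑ i, N.K i * E (Sum.inr i) ^ 2 := by
      simp only [dotProduct, mulVec_diagonal, Fintype.sum_sum_type, Sum.elim_inl, Sum.elim_inr]
      congr 1 <;> exact Finset.sum_congr rfl fun i _ => by ring
    rw [stiffness, neg_mulVec, add_mulVec, dotProduct_neg, dotProduct_add, this, neg_dotProduct]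
    ring
  have h2 : E ⬝ᵥ N.drive = - ∑ i, N.K i * N.Eset i * E (Sum.inr i) := by
    simp only [dotProduct, drive, Fintype.sum_sum_type, Sum.elim_inl, Sum.elim_inr, Pi.zero_apply,
      mul_zero, Finset.sum_const_zero, zero_add, ← Finset.sum_neg_distrib]
    exact Finset.sum_congr rfl fun i _ => by ring
  have h3 : N.Cvolt N.K E = - ∑ i, N.K i * E (Sum.inr i) ^ 2
      + 2 * ∑ i, N.K i * N.Eset i * E (Sum.inr i) - ∑ i, N.K i * N.Eset i ^ 2 := by
    simp only [Cvolt, Finset.mul_sum, ← Finset.sum_neg_distrib, ← Finset.sum_add_distrib,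
      ← Finset.sum_sub_distrib]
    exact Finset.sum_congr rfl fun i _ => by ring
  rw [cost, Qloss_eq, Qload, h1, h2, h3]
  ring

variable {N bshunt}

/-- Completing the square at a critical point of the quadratic cost. -/
theorem cost_sub_cost {E₁ E₂ : L ⊕ I → ℝ} (h : N.stiffness bshunt *ᵥ E₂ = N.drive) :
    N.cost bshunt N.K E₁ - N.cost bshunt N.K E₂ =
      (E₁ - E₂) ⬝ᵥ (N.stiffness bshunt *ᵥ (E₁ - E₂)) := by
  have hs := (N.isHermitian_stiffness bshunt).dotProduct_mulVec_comm E₁ E₂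
  rw [cost_eq, cost_eq, mulVec_sub, sub_dotProduct, dotProduct_sub, dotProduct_sub, ← hs, h]
  ring

theorem isMinimizer_iff (hA : (N.stiffness bshunt).PosDef) {E₀ : L ⊕ I → ℝ}
    (hpos : E₀ ∈ positiveVoltages (L ⊕ I)) (h : N.stiffness bshunt *ᵥ E₀ = N.drive)
    (E : L ⊕ I → ℝ) : N.IsMinimizer bshunt N.K E ↔ E = E₀ := by
  constructor
  · intro hE
    by_contra hne
    have h1 := hA.dotProduct_mulVec_pos (sub_ne_zero.2 hne)
    rw [star_trivial, ← cost_sub_cost h] at h1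
    linarith [isMinOn_iff.1 hE.2 E₀ hpos]
  · rintro rfl
    refine ⟨hpos, isMinOn_iff.2 fun E' _ => ?_⟩
    have h1 := hA.posSemidef.dotProduct_mulVec_nonneg (E' - E)
    rw [star_trivial, ← cost_sub_cost h] at h1
    linarith

theorem drive_nonneg {L I : Type*} (N : Microgrid L I) (i : L ⊕ I) : 0 ≤ N.drive i := by
  rcases i with i | i
  · exact le_rfl
  · exact mul_nonneg (neg_nonneg.2 (N.K_neg i).le) (N.Eset_pos i).le

/-- Inverse-nonnegativity gives E ≥ 0. At a zero of E the row equation equates a sum of nonpositive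
terms with a nonnegative drive, so all neighbours vanish too. Zeros then spread along a walk to an
inverter, where the drive is strictly positive. -/
theorem mem_positiveVoltages_of_stiffness_mulVec_eq [Nonempty I]
    (hA : (N.stiffness bshunt).PosDef) {E : L ⊕ I → ℝ}
    (h : N.stiffness bshunt *ᵥ E = N.drive) : E ∈ positiveVoltages (L ⊕ I) := by
  have hoff : ∀ i j, i ≠ j → N.stiffness bshunt i j ≤ 0 := fun i j hij => by
    rw [N.stiffness_of_ne bshunt hij, neg_nonpos]
    exact N.B_nonneg hij
  have hnonneg := hA.nonneg_of_mulVec_nonneg hoff (x := E) fun i => h ▸ N.drive_nonneg i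
  have hzero : ∀ u, E u = 0 → N.drive u = 0 ∧ ∀ w, N.graph.Adj u w → E w = 0 := by
    intro u hu
    have hterm : ∀ j, N.stiffness bshunt u j * E j ≤ 0 := fun j => by
      rcases eq_or_ne u j with rfl | huj
      · simp [hu]
      · exact mul_nonpos_of_nonpos_of_nonneg (hoff u j huj) (hnonneg j)
    have hsum : N.drive u = ∑ j, N.stiffness bshunt u j * E j := by rw [← h]; rfl
    have hle : ∑ j, N.stiffness bshunt u j * E j ≤ 0 := Finset.sum_nonpos fun j _ => hterm j
    have h0 : N.drive u = 0 := le_antisymm (hsum ▸ hle) (N.drive_nonneg u)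
    refine ⟨h0, fun w hw => ?_⟩
    have := (Finset.sum_eq_zero_iff_of_nonpos fun j _ => hterm j).1 (hsum ▸ h0) w
      (Finset.mem_univ w)
    refine (mul_eq_zero.1 this).resolve_left ?_
    rw [N.stiffness_of_ne bshunt hw.ne]
    exact (neg_neg_of_pos (N.B_pos hw)).ne
  intro u
  refine (hnonneg u).lt_of_ne' fun hu => ?_
  obtain ⟨k⟩ := ‹Nonempty I›
  obtain ⟨p⟩ := N.connected.preconnected u (Sum.inr k)
  have hk : ∀ {u w : L ⊕ I}, N.graph.Walk u w → E u = 0 → E w = 0 := by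
    intro u w p
    induction p with
    | nil => exact id
    | cons hadj _ ih => exact fun h0 => ih ((hzero _ h0).2 _ hadj)
  have := (hzero _ (hk p hu)).1
  exact (mul_pos (neg_pos.2 (N.K_neg k)) (N.Eset_pos k)).ne' this

theorem stiffness_mulVec_sumElim [Nonempty I] (hU : IsUnit (N.Bred + diagonal bshunt))
    {EL : L → ℝ} {EI : I → ℝ}
    (hL : EL = (N.Bred + diagonal bshunt)⁻¹ *ᵥ (N.Bred *ᵥ N.ELopen))
    (hI : EI = N.W₂ *ᵥ Sum.elim EL N.Eset) :
    N.stiffness bshunt *ᵥ Sum.elim EL EI = N.drive := by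
  have hD := (isUnit_iff_isUnit_det _).1 N.isUnit_BII_add_KI
  have hI' : (N.BII + N.KI) *ᵥ EI = -(N.BIL *ᵥ EL) + N.KI *ᵥ N.Eset := by
    rw [hI, W₂, mulVec_mulVec, mul_nonsing_inv_cancel_left _ _ hD, fromCols_mulVec_sumElim,
      neg_mulVec]
  have hI'' : EI = (N.BII + N.KI)⁻¹ *ᵥ (-(N.BIL *ᵥ EL) + N.KI *ᵥ N.Eset) := by
    rw [← hI', mulVec_mulVec, nonsing_inv_mul _ hD, one_mulVec]
  -- The factor `Bred` cancels the inverse inside `W₁`, leaving the load equation with the inverter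
  -- voltages eliminated.
  have hL' : (N.Bred + diagonal bshunt) *ᵥ EL =
      -(N.BLI *ᵥ ((N.BII + N.KI)⁻¹ *ᵥ (N.KI *ᵥ N.Eset))) := by
    rw [hL, mulVec_mulVec, mul_nonsing_inv _ ((isUnit_iff_isUnit_det _).1 hU), one_mulVec, ELopen,
      W₁, mulVec_mulVec, Matrix.mul_neg, Matrix.mul_assoc, Matrix.mul_assoc,
      mul_nonsing_inv_cancel_left _ _ ((isUnit_iff_isUnit_det _).1 N.isUnit_Bred), neg_mulVec,
      mulVec_mulVec, mulVec_mulVec, Matrix.mul_assoc]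
  rw [stiffness_eq_fromBlocks, fromBlocks_mulVec, drive]
  simp only [Sum.elim_comp_inl, Sum.elim_comp_inr]
  congr 1
  · rw [Bred, add_mulVec, sub_mulVec, ← mulVec_mulVec, ← mulVec_mulVec] at hL'
    rw [neg_mulVec, neg_mulVec, add_mulVec, hI'', mulVec_add, mulVec_add, mulVec_neg, mulVec_neg,
      ← neg_eq_zero, ← sub_eq_zero.2 hL']
    abel
  · rw [neg_mulVec, neg_mulVec, hI', KI]
    ext i
    simp [mulVec_diagonal]

/-! ### Stability of the differential-algebraic system and the conclusion. -/

theorem isLocallyExponentiallyStable [Nonempty I] (hA : (N.stiffness bshunt).PosDef)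
    {E₀ : L ⊕ I → ℝ} (heq : N.IsEquilibrium (constantImpedance bshunt) E₀) :
    N.IsLocallyExponentiallyStable (constantImpedance bshunt) E₀ := by
  obtain ⟨hpos, hE₀⟩ := (N.isEquilibrium_iff bshunt E₀).1 heq
  obtain ⟨G, R, hR, hG, hGR⟩ := hA.exists_kron_reduction
  obtain ⟨g, hg, hgb⟩ := G.exists_norm_mulVec_le
  set a : I → ℝ := fun i => E₀ (Sum.inr i) with ha
  have hconsistent : ∀ E, N.IsConsistent (constantImpedance bshunt) E ↔
      E ∈ positiveVoltages (L ⊕ I) ∧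
        E = Sum.elim (G *ᵥ fun i => E (Sum.inr i)) fun i => E (Sum.inr i) := fun E => by
    rw [isConsistent_iff]
    refine and_congr_right fun _ => ?_
    conv_lhs => rw [← Sum.elim_comp_inl_inr E]
    rw [hG]
    constructor
    · intro h
      conv_lhs => rw [← Sum.elim_comp_inl_inr E, h]
      rfl
    · intro h
      conv_lhs => rw [h]
      rfl
  have hE₀' := ((hconsistent E₀).1 heq.1).2
  -- The equilibrium is itself consistent, so the drive is absorbed into a and the reduced system is
  -- centred there.
  have hdrive : ∀ i, N.drive (Sum.inr i) = (R *ᵥ a) i := fun i => by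
    rw [← hE₀, ← hGR, ← hE₀']
  have hdroop : ∀ x i, N.droopInput (Sum.elim (G *ᵥ x) x) i = - x i * (R *ᵥ (x - a)) i := by
    intro x i
    rw [N.droopInput_eq bshunt, hdrive, hGR, mulVec_sub, Pi.sub_apply, Sum.elim_inr]
    ring
  have hinr : ∀ E : L ⊕ I → ℝ, ‖(fun i => E (Sum.inr i)) - a‖ ≤ ‖E - E₀‖ := fun E =>
    (pi_norm_le_iff_of_nonneg (norm_nonneg _)).2 fun i => norm_le_pi_norm (E - E₀) (Sum.inr i)
  have hnorm : ∀ x : I → ℝ, ‖Sum.elim (G *ᵥ x) x - E₀‖ ≤ (g + 1) * ‖x - a‖ := by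
    intro x
    rw [hE₀']
    refine (pi_norm_le_iff_of_nonneg (by positivity)).2 fun i => ?_
    rcases i with i | i
    · calc ‖(G *ᵥ x) i - (G *ᵥ a) i‖ = ‖(G *ᵥ (x - a)) i‖ := by rw [mulVec_sub, Pi.sub_apply]
        _ ≤ g * ‖x - a‖ := (norm_le_pi_norm _ i).trans (hgb _)
        _ ≤ _ := by gcongr; linarith
    · calc ‖x i - a i‖ ≤ ‖x - a‖ := norm_le_pi_norm (x - a) i
        _ ≤ _ := le_mul_of_one_le_left (norm_nonneg _) (by linarith)
  obtain ⟨δ₁, hδ₁, c, hc, r, hr, hdecay⟩ :=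
    exists_exponential_decay (τ := N.τ) N.τ_pos hR (a := a) fun i => hpos _
  obtain ⟨ε, hε, hεE⟩ := exists_forall_le_of_pos hpos
  -- Lifting from x to (G x, x) expands distances to the equilibrium by at most g + 1, so this η
  -- keeps all voltages, loads included, within ε of E₀ and hence positive.
  obtain ⟨δ₂, hδ₂, hexist⟩ := exists_isReducedSolutionOn_Ici (τ := N.τ) N.τ_pos hR (a := a)
    (fun i => hpos _) (η := ε / (g + 1)) (by positivity)
  refine ⟨heq, min δ₁ δ₂, lt_min hδ₁ hδ₂, (g + 1) * c, by positivity, r, hr, ?_, ?_⟩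
  · intro E₁ hE₁ hlt
    obtain ⟨x, hx0, hx, hxε⟩ := hexist (fun i => E₁ (Sum.inr i))
      ((hinr E₁).trans_lt (hlt.trans_le (min_le_right _ _)))
    refine ⟨fun t => Sum.elim (G *ᵥ x t) (x t), ⟨?_, fun t ht => ⟨?_, fun i => ?_⟩⟩, ?_⟩
    · have hxc : ContinuousOn x (Ici 0) := continuousOn_pi.2 fun i t ht => by
        obtain ⟨v, hv, -⟩ := (hx t ht).2 i
        exact hv.continuousWithinAt
      refine continuousOn_pi.2 fun i => ?_
      rcases i with i | i
      · exact (by fun_prop : Continuous fun y : I → ℝ => (G *ᵥ y) i).comp_continuousOn hxc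
      · exact continuousOn_pi.1 hxc i
    · refine (hconsistent _).2 ⟨fun i => ?_, rfl⟩
      have h1 : ‖Sum.elim (G *ᵥ x t) (x t) - E₀‖ < ε := (hnorm _).trans_lt <| by
        rw [mul_comm, ← lt_div_iff₀ (by positivity)]
        exact hxε t ht
      have h2 := (norm_le_pi_norm (Sum.elim (G *ᵥ x t) (x t) - E₀) i).trans_lt h1
      rw [Real.norm_eq_abs, Pi.sub_apply] at h2
      linarith [(abs_lt.1 h2).1, hεE i]
    · obtain ⟨v, hv, hv'⟩ := (hx t ht).2 i
      exact ⟨v, hv, by rw [hv', hdroop]⟩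
    · simp only [hx0]
      exact ((hconsistent E₁).1 hE₁).2.symm
  · intro T hT E hE hlt t ht
    have hEx : ∀ t ∈ Ico 0 T, E t =
        Sum.elim (G *ᵥ fun i => E t (Sum.inr i)) fun i => E t (Sum.inr i) := fun t ht =>
      ((hconsistent (E t)).1 (hE.2 t ht).1).2
    have hred : IsReducedSolutionOn N.τ R a (Ico 0 T) fun t i => E t (Sum.inr i) := by
      refine fun t ht => ⟨fun i => (hE.2 t ht).1.1 _, fun i => ?_⟩
      obtain ⟨v, hv, hv'⟩ := (hE.2 t ht).2 i
      refine ⟨v, hv, ?_⟩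
      rw [hv', hEx t ht, hdroop]
    calc ‖E t - E₀‖ ≤ (g + 1) * ‖(fun i => E t (Sum.inr i)) - a‖ := by
          conv_lhs => rw [hEx t ht]
          exact hnorm _
      _ ≤ (g + 1) * (c * Real.exp (-r * t) * ‖(fun i => E 0 (Sum.inr i)) - a‖) := by
          gcongr
          exact hdecay T hT _ hred ((hinr _).trans_lt (hlt.trans_le (min_le_left _ _))) t ht
      _ ≤ (g + 1) * (c * Real.exp (-r * t) * ‖E 0 - E₀‖) := by
          gcongr
          exact hinr _
      _ = _ := by ring

end Microgrid

theorem proposition1 {L I : Type*} [Fintype L] [Fintype I] [DecidableEq L] [DecidableEq I]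
    [Nonempty L] [Nonempty I] (N : Microgrid L I) (bshunt : L → ℝ) (κ : I → ℝ)
    (_hκ : ∀ i, κ i < 0)
    (_hM : IsMMatrix (-(N.Bred + Matrix.diagonal bshunt)))
    (_hK : ∀ i, N.K i = κ i) :
    -- the inverses in the formulas exist
    IsUnit (N.BII + N.KI) ∧ IsUnit N.Bred ∧ IsUnit (N.Bred + Matrix.diagonal bshunt) ∧
    ∃ (EL : L → ℝ) (EI : I → ℝ),
      EL = (N.Bred + Matrix.diagonal bshunt)⁻¹ *ᵥ (N.Bred *ᵥ N.ELopen) ∧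
      EI = N.W₂ *ᵥ Sum.elim EL N.Eset ∧
      (∀ i, 0 < EL i) ∧ (∀ i, 0 < EI i) ∧
      N.IsLocallyExponentiallyStable (constantImpedance bshunt) (Sum.elim EL EI) ∧
      (∀ E, N.IsEquilibrium (constantImpedance bshunt) E ↔ E = Sum.elim EL EI) ∧
      (∀ E, N.IsMinimizer bshunt κ E ↔ E = Sum.elim EL EI) := by
  obtain rfl : N.K = κ := funext _hK
  have hS := _hM.posDef (N.isHermitian_Bred_add_diagonal bshunt)
  have hA := (N.posDef_stiffness_iff bshunt).2 hS
  have hU : IsUnit (N.Bred + Matrix.diagonal bshunt) := (IsUnit.neg_iff _).1 hS.isUnit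
  refine ⟨N.isUnit_BII_add_KI, N.isUnit_Bred, hU, _, _, rfl, rfl, ?_⟩
  set EL := (N.Bred + Matrix.diagonal bshunt)⁻¹ *ᵥ (N.Bred *ᵥ N.ELopen) with hEL
  set EI := N.W₂ *ᵥ Sum.elim EL N.Eset with hEI
  have heq := Microgrid.stiffness_mulVec_sumElim hU hEL hEI
  have hpos := Microgrid.mem_positiveVoltages_of_stiffness_mulVec_eq hA heq
  refine ⟨fun i => hpos (Sum.inl i), fun i => hpos (Sum.inr i),
    Microgrid.isLocallyExponentiallyStable hA ((N.isEquilibrium_iff bshunt _).2 ⟨hpos, heq⟩),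
    fun E => ⟨fun hE => ?_, ?_⟩, Microgrid.isMinimizer_iff hA hpos heq⟩
  · exact mulVec_injective_of_isUnit hA.isUnit
      ((((N.isEquilibrium_iff bshunt _).1 hE).2).trans heq.symm)
  · rintro rfl
    exact (N.isEquilibrium_iff bshunt _).2 ⟨hpos, heq⟩
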